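/- All manifolds are smooth ($C^\infty$), Hausdorff, second countable, without boundary. **Spaces.** A *simple space* is a second countable metrizable space $X$ with an open dense subset $R$ (the regular part) that is a manifold of dimension $n$, and whose complement $\Sigma$ (the singular part) is the topological disjoint union of its connected components (the singular strata), each of which is a manifold. For a compact manifold $L$ let $c(L)=L\times[0,\infty)/L\times\{0\}$ be its open cone, with points $[l,r]$ and vertex $v$. A *chart* of $X$ along a singular stratum $S$ with link $L$ is a homeomorphism $\alpha$ from $U\times c(L)$, with $U\subset S$ open, onto an open subset of $X$, such that $\alpha(u,v)=u$ and such that $\alpha$ maps $U\times L\times(0,\infty)$ diffeomorphically onto an open subset of $R$. A *tubular neighbourhood* of $S$ is a fibre bundle $\tau:T\to S$ with fibre $c(L)$, where $T$ is an open neighbourhood of $S$ in $X$, $\tau|_S=\mathrm{id}$, and the bundle charts are charts of $X$ along $S$ whose changes are of the form $(u,[l,r])\mapsto(u,[g(u)(l),r])$ with $g(u)$ a diffeomorphism of $L$. A *bundle chart* means any chart along $S$ that is compatible, in this sense, with the given bundle atlas. A *Thom–Mather space* is a simple space together with a tubular neighbourhood of each singular stratum. **Unfoldings.** An *unfolding*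 of a Thom–Mather space $X$ is a continuous proper map $\mathcal L:\widetilde X\to X$ from a manifold $\widetilde X$ such that 1. $\mathcal L^{-1}(R)\to R$ is a finite smooth trivial covering; 2. for each $z\in\mathcal L^{-1}(\Sigma)$, lying over the stratum $S$ with link $L$, there are a bundle chart $\alpha:U\times c(L)\to X$ of the tubular neighbourhood of $S$, with $\mathcal L(z)\in U$, and a diffeomorphism $\widetilde\alpha:U\times L\times\mathbb R\to\mathcal L^{-1}(\operatorname{Im}\alpha)$ with $\mathcal L(\widetilde\alpha(u,l,t))=\alpha(u,[l,|t|])$. It is *primary* if $\mathcal L^{-1}(R)$ is the disjoint union of exactly two copies of $R$, i.e. the covering in (1) is a trivial double covering. A *bubble* is a connected component of $\mathcal L^{-1}(R)$. For two unfoldings $\mathcal L,\mathcal L'$ of $X$, a *bubble labelling* is a bijection from the bubbles of $\mathcal L$ to those of $\mathcal L'$ such that corresponding bubbles lie over the same connected component of $R$. **Corollary (uniqueness of primary unfoldings).** Let $\mathcal L:\widetilde X\to X$ and $\mathcal L':\widetilde X'\to X$ be two primary unfoldings of the same Thom–Mather space $X$. Then there is a diffeomorphism $\varphi:\widetilde X\to\widetilde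 X'$ over $X$, i.e. with $\mathcal L'\circ\varphi=\mathcal L$. Moreover, $\varphi$ is unique up to the labelling of the bubbles: each diffeomorphism over $X$ induces exactly one bubble labelling, and each bubble labelling is induced by exactly one diffeomorphism over $X$. -/

import Mathlib

open scoped Manifold ContDiff NNReal
open TopologicalSpace

universe u v w w'

/-! ### Open cones -/

/-- A point of `{v} ⊔ L × [0,∞)` that represents the vertex of the open cone of `L`. -/
def ConeVertexRep (L : Type u) : Unit ⊕ (L × ℝ≥0) → Prop
  | Sum.inl _ => True
  | Sum.inr q => q.2 = 0

/-- The relation that identifies all representatives of the vertex with one another. -/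
def coneSetoid (L : Type u) : Setoid (Unit ⊕ (L × ℝ≥0)) where
  r x y := x = y ∨ (ConeVertexRep L x ∧ ConeVertexRep L y)
  iseqv := by
    refine ⟨fun x => Or.inl rfl, ?_, ?_⟩
    · rintro x y (h | h)
      · exact Or.inl h.symm
      · exact Or.inr h.symm
    · rintro x y z (rfl | h) (rfl | h')
      · exact Or.inl rfl
      · exact Or.inr h'
      · exact Or.inr h
      · exact Or.inr ⟨h.1, h'.2⟩

/-- The open cone `c(L) = L × [0,∞) / L × {0}`, with the quotient topology. The extra point of the
disjoint union is identified with every `(l, 0)`, so it changes nothing when `L` is nonempty, and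
it makes `c(∅)` a singleton. -/
def OpenCone (L : Type u) : Type u := Quotient (coneSetoid L)

namespace OpenCone

instance (L : Type u) [TopologicalSpace L] : TopologicalSpace (OpenCone L) :=
  inferInstanceAs (TopologicalSpace (Quotient (coneSetoid L)))

/-- The vertex of the cone. -/
def vertex (L : Type u) : OpenCone L := Quotient.mk (coneSetoid L) (Sum.inl ())

/-- The class `[l, r]`. -/
def mk {L : Type u} (l : L) (r : ℝ≥0) : OpenCone L := Quotient.mk (coneSetoid L) (Sum.inr (l, r))

end OpenCone

/-- The manifold `(0,∞)`, as an open subset of the real line. -/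
def PosReal : Opens ℝ := ⟨Set.Ioi 0, isOpen_Ioi⟩

/-! ### Simple spaces -/

/-- The connected components of the complement of an open set. -/
abbrev ComplComponents {X : Type u} [TopologicalSpace X] (R : Opens X) : Type u :=
  ConnectedComponents (↥((R : Set X)ᶜ))

/-- A connected component of the complement of an open set, as a subset of the space. -/
def complComponentSet {X : Type u} [TopologicalSpace X] (R : Opens X) (c : ComplComponents R) :
    Set X :=
  {x | ∃ h : x ∈ (R : Set X)ᶜ, ConnectedComponents.mk (⟨x, h⟩ : ↥((R : Set X)ᶜ)) = c}

/-- A decomposition of `X` that makes it a simple space: `X` is a second countable metrizable space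
with an open dense subset `R` (the regular part) which is a smooth manifold of dimension `n`, and
the complement `Σ` of `R` (the singular part) is the topological disjoint union of its connected
components, which are smooth manifolds (of possibly different dimensions). -/
structure SimpleSpace (X : Type u) [TopologicalSpace X] where
  metrizable : MetrizableSpace X
  secondCountable : SecondCountableTopology X
  /-- the regular part -/
  R : Opens X
  dense_R : Dense (R : Set X)
  /-- the dimension of the regular part -/
  n : ℕ
  /-- the smooth atlas of the regular part -/
  chartedR : ChartedSpace (EuclideanSpace ℝ (Fin n)) R
  manifoldR : IsManifold (𝓡 n) ∞ R
  isOpen_component : ∀ c : ComplComponents R,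
    IsOpen ({x : ↥((R : Set X)ᶜ) | ConnectedComponents.mk x = c} : Set ↥((R : Set X)ᶜ))
  /-- the dimension of a component of the singular part -/
  d : ComplComponents R → ℕ
  /-- the smooth atlas of a component of the singular part -/
  chartedS : ∀ c, ChartedSpace (EuclideanSpace ℝ (Fin (d c))) (complComponentSet R c)
  manifoldS : ∀ c, IsManifold (𝓡 (d c)) ∞ (complComponentSet R c)

attribute [instance] SimpleSpace.chartedR SimpleSpace.manifoldR SimpleSpace.chartedS
  SimpleSpace.manifoldS

namespace SimpleSpace

variable {X : Type u} [TopologicalSpace X]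

/-- The index set of the singular strata. -/
abbrev SingStratum (A : SimpleSpace X) : Type u := ComplComponents A.R

/-- A singular stratum, i.e. a connected component of the singular part. -/
abbrev stratum (A : SimpleSpace X) (c : A.SingStratum) : Set X := complComponentSet A.R c

end SimpleSpace

/-! ### Charts and tubular neighbourhoods -/

/-- A chart of the simple space `X` along the singular stratum `S`, with link `L`: an embedding
`α : U × c(L) → X` of simple spaces onto an open subset of `X`, where `U` is open in `S` and
`α (u, v) = u`. On the regular part `U × L × (0,∞)` it is a diffeomorphism onto an open subset
of `R` (it is injective and a local diffeomorphism). -/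
structure ConeChart {X : Type u} [TopologicalSpace X] (A : SimpleSpace X) (c : A.SingStratum)
    (L : Type v) [TopologicalSpace L] (k : ℕ) [ChartedSpace (EuclideanSpace ℝ (Fin k)) L] where
  /-- the base of the chart -/
  U : Opens (A.stratum c)
  /-- the map of the chart -/
  toFun : U × OpenCone L → X
  isOpenEmbedding : Topology.IsOpenEmbedding toFun
  map_vertex : ∀ u : U, toFun (u, OpenCone.vertex L) = ((u : A.stratum c) : X)
  map_regular : ∀ (u : U) (l : L) (r : PosReal),
    toFun (u, OpenCone.mk l (Real.toNNReal (r : ℝ))) ∈ A.R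
  isLocalDiffeomorph :
    IsLocalDiffeomorph ((𝓡 (A.d c)).prod ((𝓡 k).prod 𝓘(ℝ, ℝ))) (𝓡 A.n) ∞
      (fun q : U × L × PosReal =>
        (⟨toFun (q.1, OpenCone.mk q.2.1 (Real.toNNReal (q.2.2 : ℝ))),
          map_regular q.1 q.2.1 q.2.2⟩ : A.R))

/-- The change of charts between `α` and `β` has the form `(u, [l, r]) ↦ (u, [g(u)(l), r])` with
`g(u)` a diffeomorphism of the link. -/
def ConeChart.Compatible {X : Type u} [TopologicalSpace X] {A : SimpleSpace X} {c : A.SingStratum}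
    {L : Type v} [TopologicalSpace L] {k : ℕ} [ChartedSpace (EuclideanSpace ℝ (Fin k)) L]
    (α β : ConeChart A c L k) : Prop :=
  ∀ (u : A.stratum c) (hα : u ∈ α.U) (hβ : u ∈ β.U),
    ∃ g : L ≃ₘ^∞⟮𝓡 k, 𝓡 k⟯ L, ∀ (l : L) (r : ℝ≥0),
      α.toFun (⟨u, hα⟩, OpenCone.mk l r) = β.toFun (⟨u, hβ⟩, OpenCone.mk (g l) r)

/-- A tubular neighbourhood of the singular stratum `S`: a fibre bundle `τ : T → S` whose total
space is an open neighbourhood of `S` in `X`, whose fibre is the open cone of a compact manifold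
(the link of `S`), which restricts to the identity on `S`, and whose changes of charts come from
diffeomorphisms of the link. -/
structure TubularNbhd {X : Type u} [TopologicalSpace X] (A : SimpleSpace X)
    (c : A.SingStratum) where
  /-- the link of the stratum -/
  Link : Type v
  topLink : TopologicalSpace Link
  t2Link : T2Space Link
  compactLink : CompactSpace Link
  /-- the dimension of the link -/
  k : ℕ
  chartedLink : ChartedSpace (EuclideanSpace ℝ (Fin k)) Link
  manifoldLink : IsManifold (𝓡 k) ∞ Link
  /-- the total space -/
  T : Opens X
  stratum_subset : A.stratum c ⊆ T
  /-- the projection -/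
  τ : T → A.stratum c
  continuous_τ : Continuous τ
  τ_stratum : ∀ x : A.stratum c, τ ⟨x, stratum_subset x.2⟩ = x
  /-- the bundle charts -/
  atlas : Set (ConeChart A c Link k)
  range_eq : ∀ α ∈ atlas, Set.range α.toFun = {x | ∃ h : x ∈ T, τ ⟨x, h⟩ ∈ α.U}
  τ_eq : ∀ α ∈ atlas, ∀ (q : α.U × OpenCone Link) (h : α.toFun q ∈ T), τ ⟨α.toFun q, h⟩ = q.1
  covers : ∀ x : A.stratum c, ∃ α ∈ atlas, x ∈ α.U
  compatible : ∀ α ∈ atlas, ∀ β ∈ atlas, α.Compatible β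

attribute [instance] TubularNbhd.topLink TubularNbhd.t2Link TubularNbhd.compactLink
  TubularNbhd.chartedLink TubularNbhd.manifoldLink

/-- A chart is a bundle chart of the tubular neighbourhood if it belongs to the maximal bundle
atlas, i.e. if it is compatible with all the charts of the given atlas. -/
def TubularNbhd.IsBundleChart {X : Type u} [TopologicalSpace X] {A : SimpleSpace X}
    {c : A.SingStratum} (t : TubularNbhd.{u, v} A c) (α : ConeChart A c t.Link t.k) : Prop :=
  ∀ β ∈ t.atlas, α.Compatible β

/-- A Thom-Mather simple space: a simple space with a tubular neighbourhood of each singular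
stratum. (In particular it is a pseudomanifold: bundle charts are charts.) -/
structure ThomMatherSpace (X : Type u) [TopologicalSpace X] extends SimpleSpace X where
  /-- the tubular neighbourhoods -/
  tube : ∀ c : toSimpleSpace.SingStratum, TubularNbhd.{u, v} toSimpleSpace c

/-! ### Unfoldings -/

section Unfoldings

variable {X : Type u} [TopologicalSpace X] {Y : Type w} [TopologicalSpace Y]

/-- `p` restricts to a smooth trivial covering `p⁻¹(R) → R` with `m` sheets: `p⁻¹(R)` is the
disjoint union of the images of `m` smooth sections, each of which is a diffeomorphism from `R`
onto an open subset of `Y`. -/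
def IsTrivialCoverOverRegular (A : SimpleSpace X) [ChartedSpace (EuclideanSpace ℝ (Fin A.n)) Y]
    (p : Y → X) (m : ℕ) : Prop :=
  ∃ s : Fin m → A.R → Y,
    (∀ j, IsLocalDiffeomorph (𝓡 A.n) (𝓡 A.n) ∞ (s j)) ∧
    (∀ j x, p (s j x) = x) ∧
    (∀ i j x y, s i x = s j y → i = j) ∧
    (∀ z, p z ∈ A.R → ∃ j x, s j x = z)

/-- `α' : U × L × ℝ → Y` is an unfolded chart of `p` over the chart `α : U × c(L) → X`: it is a
diffeomorphism onto `p⁻¹(im α)` and `p (α' (u, l, t)) = α (u, [l, |t|])`. -/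
def IsUnfoldedChart {A : SimpleSpace X} [ChartedSpace (EuclideanSpace ℝ (Fin A.n)) Y]
    {c : A.SingStratum} {L : Type v} [TopologicalSpace L] {k : ℕ}
    [ChartedSpace (EuclideanSpace ℝ (Fin k)) L]
    (p : Y → X) (α : ConeChart A c L k) (α' : α.U × L × ℝ → Y) : Prop :=
  IsLocalDiffeomorph ((𝓡 (A.d c)).prod ((𝓡 k).prod 𝓘(ℝ, ℝ))) (𝓡 A.n) ∞ α' ∧
  Function.Injective α' ∧
  Set.range α' = p ⁻¹' Set.range α.toFun ∧
  ∀ (u : α.U) (l : L) (t : ℝ), p (α' (u, l, t)) = α.toFun (u, OpenCone.mk l (Real.nnabs t))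

/-- An unfolding of the Thom-Mather space `X`: a continuous proper map `p` from a manifold to `X`
which is a finite smooth trivial covering over the regular part, and which has around each point
over the singular part an unfolded chart. The charts of a Thom-Mather space along a stratum are the
bundle charts of the tubular neighbourhood (with arbitrary charts, both `t ↦ |t|` and `t ↦ t ^ 2`
would be unfoldings `ℝ → [0,∞)`, although no diffeomorphism of `ℝ` intertwines them). -/
structure IsUnfolding (A : ThomMatherSpace.{u, v} X)
    [ChartedSpace (EuclideanSpace ℝ (Fin A.n)) Y] (p : Y → X) : Prop where
  continuous : Continuous p
  proper : IsProperMap p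
  cover : ∃ m : ℕ, IsTrivialCoverOverRegular A.toSimpleSpace p m
  exists_chart : ∀ (z : Y) (c : A.SingStratum) (hz : p z ∈ A.stratum c),
    ∃ α : ConeChart A.toSimpleSpace c (A.tube c).Link (A.tube c).k,
      (A.tube c).IsBundleChart α ∧ (⟨p z, hz⟩ : A.stratum c) ∈ α.U ∧
      ∃ α' : α.U × (A.tube c).Link × ℝ → Y, IsUnfoldedChart p α α'

/-- A primary unfolding: the preimage of the regular part is exactly two copies of it. -/
structure IsPrimaryUnfolding (A : ThomMatherSpace.{u, v} X)
    [ChartedSpace (EuclideanSpace ℝ (Fin A.n)) Y] (p : Y → X) : Prop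
    extends IsUnfolding A p where
  double : IsTrivialCoverOverRegular A.toSimpleSpace p 2

/-- The bubbles: the connected components of the preimage of the regular part. -/
abbrev Bubble (A : SimpleSpace X) (p : Y → X) : Type w :=
  ConnectedComponents (↥(p ⁻¹' (A.R : Set X)))

/-- The bubble of a point over the regular part. -/
def bubbleOf (A : SimpleSpace X) (p : Y → X) (z : Y) (hz : p z ∈ A.R) : Bubble A p :=
  ConnectedComponents.mk ⟨z, hz⟩

end Unfoldings

section Labelling

variable {X : Type u} [TopologicalSpace X] {Y : Type w} [TopologicalSpace Y]
  {Y' : Type w'} [TopologicalSpace Y']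

/-- A labelling of the bubbles of `p'` by those of `p`: a bijection between the bubbles such that
corresponding bubbles lie over the same connected component of the regular part. -/
def IsBubbleLabelling (A : SimpleSpace X) (p : Y → X) (p' : Y' → X)
    (σ : Bubble A p ≃ Bubble A p') : Prop :=
  ∀ (z : Y) (z' : Y') (hz : p z ∈ A.R) (hz' : p' z' ∈ A.R),
    σ (bubbleOf A p z hz) = bubbleOf A p' z' hz' →
      ConnectedComponents.mk (⟨p z, hz⟩ : A.R) = ConnectedComponents.mk (⟨p' z', hz'⟩ : A.R)

/-- The map `φ` sends each bubble `b` to the bubble `σ b`. -/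
def InducesOnBubbles (A : SimpleSpace X) (p : Y → X) (p' : Y' → X) (φ : Y → Y')
    (σ : Bubble A p ≃ Bubble A p') : Prop :=
  ∀ (z : Y) (hz : p z ∈ A.R), ∃ hz' : p' (φ z) ∈ A.R,
    σ (bubbleOf A p z hz) = bubbleOf A p' (φ z) hz'

end Labelling

open Filter Topology

/-! Over the regular part both unfoldings are trivial double coverings, so isomorphisms there are
easy to write down; the point is to extend one smoothly across the singular strata.

Two bundle charts over the same base point differ by `(u, [l, r]) ↦ (u, [g(u)(l), r])`, with the
radius preserved. Hence in unfolded charts a map over `X` reads `(u, l, t) ↦ (u, g(u)(l), ±t)` for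
`t ≠ 0`. Near a point with `t = 0` the sign is constant on `t > 0` by connectedness, and injectivity
forces the same sign on `t < 0`. The formula is then smooth through `t = 0`
(`IsUnfoldedChart.exists_contMDiffAt_eqOn`). Since the preimage of the regular part is dense, the
local extensions glue, and the extension of the inverse is the inverse of the extension
(`MapsSheets.exists_diffeomorph`).

Existence follows by matching the sheets by index. For the labellings, a bubble meets each fibre at
most once (`IsSheets.eq_of_bubbleOf_eq`), so a labelling determines the isomorphism over the regular
part, and by density the diffeomorphism. -/

/-! ### Points of the cone and smoothness of changes of charts. -/

theorem OpenCone.mk_eq_vertex_iff {L : Type u} {l : L} {r : ℝ≥0} :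
    OpenCone.mk l r = OpenCone.vertex L ↔ r = 0 := by
  constructor
  · intro h
    rcases Quotient.exact h with h | h
    · exact absurd h (by simp)
    · exact h.1
  · rintro rfl
    exact Quotient.sound (Or.inr ⟨rfl, trivial⟩)

theorem OpenCone.mk_inj {L : Type u} {l l' : L} {r r' : ℝ≥0} (hr : r ≠ 0)
    (h : OpenCone.mk l r = OpenCone.mk l' r') : l = l' ∧ r = r' := by
  rcases Quotient.exact h with h | h
  · simpa using h
  · exact absurd h.1 hr

section Charts

variable {X : Type u} [TopologicalSpace X] {A : SimpleSpace X} {c : A.SingStratum}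
  {L : Type v} [TopologicalSpace L] {k : ℕ} [ChartedSpace (EuclideanSpace ℝ (Fin k)) L]

theorem ConeChart.mem_R (α : ConeChart A c L k) (u : α.U) (l : L) {r : ℝ≥0} (hr : r ≠ 0) :
    α.toFun (u, OpenCone.mk l r) ∈ A.R := by
  have h := α.map_regular u l ⟨(r : ℝ), pos_iff_ne_zero.2 hr⟩
  simpa using h

theorem ConeChart.toFun_mk_inj (α : ConeChart A c L k) {u u' : α.U} {l l' : L} {r r' : ℝ≥0}
    (hr : r ≠ 0) (h : α.toFun (u, OpenCone.mk l r) = α.toFun (u', OpenCone.mk l' r')) :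
    u = u' ∧ l = l' ∧ r = r' := by
  have h' := Prod.ext_iff.1 (α.isOpenEmbedding.injective h)
  exact ⟨h'.1, OpenCone.mk_inj hr h'.2⟩

/-- The restriction of a chart to the regular part. -/
def ConeChart.regular (α : ConeChart A c L k) (q : α.U × L × PosReal) : A.R :=
  ⟨α.toFun (q.1, OpenCone.mk q.2.1 (Real.toNNReal (q.2.2 : ℝ))), α.map_regular q.1 q.2.1 q.2.2⟩

theorem ConeChart.regular_injective (α : ConeChart A c L k) : Function.Injective α.regular := by
  rintro ⟨u, l, r, hr⟩ ⟨u', l', r', hr'⟩ h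
  have h0 : Real.toNNReal r ≠ 0 := (Real.toNNReal_pos.2 hr).ne'
  obtain ⟨rfl, rfl, h3⟩ := α.toFun_mk_inj h0 (congrArg Subtype.val h)
  have : r = r' := (Real.toNNReal_eq_toNNReal_iff (le_of_lt hr) (le_of_lt hr')).1 h3
  subst this
  rfl

/-- Around each point, the change of compatible charts is induced by a smooth change of base point
and link. -/
theorem ConeChart.Compatible.exists_change {α β : ConeChart A c L k} (h : α.Compatible β)
    (u₀ : α.U) (hu₀ : (u₀ : A.stratum c) ∈ β.U) (l₀ : L) :
    ∃ N ∈ 𝓝 (u₀, l₀), ∃ G : α.U × L → β.U × L,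
      ContMDiffOn ((𝓡 (A.d c)).prod (𝓡 k)) ((𝓡 (A.d c)).prod (𝓡 k)) ∞ G N ∧
      ∀ q ∈ N, ∀ r : ℝ≥0,
        α.toFun (q.1, OpenCone.mk q.2 r) = β.toFun ((G q).1, OpenCone.mk (G q).2 r) := by
  -- Compatibility gives `g(u)` for each `u` separately, with no regularity in `u`. As `g(u)` does
  -- not depend on the radius, it can be read off at radius 1, where both charts are local
  -- diffeomorphisms.
  let one : PosReal := ⟨1, (one_pos : (0 : ℝ) < 1)⟩
  obtain ⟨g₀, hg₀⟩ := h u₀ u₀.2 hu₀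
  let w₀ : β.U × L × PosReal := (⟨u₀, hu₀⟩, g₀ l₀, one)
  have hw₀ : α.regular (u₀, l₀, one) = β.regular w₀ := Subtype.ext (hg₀ l₀ _)
  have hβ := β.isLocalDiffeomorph w₀
  let e : α.U × L → A.R := fun q => α.regular (q.1, q.2, one)
  have he : ContMDiff ((𝓡 (A.d c)).prod (𝓡 k)) (𝓡 A.n) ∞ e :=
    α.isLocalDiffeomorph.contMDiff.comp
      (contMDiff_fst.prodMk (contMDiff_snd.prodMk contMDiff_const))
  let Ψ := hβ.localInverse
  have hΨ : ∀ y ∈ Ψ.source, β.regular (Ψ y) = y := fun y hy => hβ.localInverse_right_inv hy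
  have hmem : e (u₀, l₀) ∈ Ψ.source := by
    have : e (u₀, l₀) = β.regular w₀ := hw₀
    rw [this]
    exact hβ.localInverse_mem_source
  let N : Set (α.U × L) := e ⁻¹' Ψ.source ∩ {q | (q.1 : A.stratum c) ∈ β.U}
  have hN : IsOpen N :=
    (Ψ.open_source.preimage he.continuous).inter
      (β.U.isOpen.preimage (continuous_subtype_val.comp continuous_fst))
  refine ⟨N, hN.mem_nhds ⟨hmem, hu₀⟩, fun q => ((Ψ (e q)).1, (Ψ (e q)).2.1), ?_, ?_⟩
  · have h1 := Ψ.contMDiffOn.comp he.contMDiffOn (s := N) fun q hq => hq.1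
    have h2 : ContMDiff ((𝓡 (A.d c)).prod ((𝓡 k).prod 𝓘(ℝ, ℝ)))
        ((𝓡 (A.d c)).prod (𝓡 k)) ∞ (fun q : β.U × L × PosReal => (q.1, q.2.1)) :=
      contMDiff_fst.prodMk (contMDiff_fst.comp contMDiff_snd)
    exact h2.comp_contMDiffOn h1
  · rintro ⟨u, l⟩ ⟨hq, hu⟩ r
    obtain ⟨g, hg⟩ := h u u.2 hu
    have h1 : Ψ (e (u, l)) = (⟨u, hu⟩, g l, one) :=
      β.regular_injective ((hΨ _ hq).trans (Subtype.ext (hg l _)))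
    simp only [h1]
    exact hg l r

/-- The bundle charts of a tubular neighbourhood are compatible with one another. -/
theorem TubularNbhd.IsBundleChart.compatible {t : TubularNbhd.{u, v} A c}
    {α β : ConeChart A c t.Link t.k} (hα : t.IsBundleChart α) (hβ : t.IsBundleChart β) :
    α.Compatible β := by
  intro u hu hu'
  obtain ⟨γ, hγ, huγ⟩ := t.covers u
  obtain ⟨g, hg⟩ := hα γ hγ u hu huγ
  obtain ⟨g', hg'⟩ := hβ γ hγ u hu' huγ
  refine ⟨g.trans g'.symm, fun l r => ?_⟩
  rw [hg, hg']
  simp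

end Charts

/-! ### Sheets and bubbles over the regular part. -/

section Sheets

variable {X : Type u} [TopologicalSpace X] {A : SimpleSpace X}
  {Y : Type w} [TopologicalSpace Y] [ChartedSpace (EuclideanSpace ℝ (Fin A.n)) Y]
  {Y' : Type w'} [TopologicalSpace Y'] [ChartedSpace (EuclideanSpace ℝ (Fin A.n)) Y']

/-- The images of the sections `s` are the sheets of a smooth trivial covering `p⁻¹(R) → R`. -/
structure IsSheets (A : SimpleSpace X) [ChartedSpace (EuclideanSpace ℝ (Fin A.n)) Y]
    (p : Y → X) {m : ℕ} (s : Fin m → A.R → Y) : Prop where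
  isLocalDiffeomorph : ∀ j, IsLocalDiffeomorph (𝓡 A.n) (𝓡 A.n) ∞ (s j)
  map_eq : ∀ j x, p (s j x) = x
  index_eq : ∀ i j x y, s i x = s j y → i = j
  exists_eq : ∀ z, p z ∈ A.R → ∃ j x, s j x = z

variable {p : Y → X} {p' : Y' → X} {m : ℕ} {s : Fin m → A.R → Y} {s' : Fin m → A.R → Y'}

theorem IsSheets.mem_R (hs : IsSheets A p s) (j : Fin m) (x : A.R) : p (s j x) ∈ A.R := by
  rw [hs.map_eq]
  exact x.2

theorem IsSheets.exists_eq' (hs : IsSheets A p s) {z : Y} (hz : p z ∈ A.R) :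
    ∃ j, s j ⟨p z, hz⟩ = z := by
  obtain ⟨j, x, rfl⟩ := hs.exists_eq z hz
  exact ⟨j, congrArg (s j) (Subtype.ext (hs.map_eq j x))⟩

theorem IsSheets.isOpen_range (hs : IsSheets A p s) (j : Fin m) : IsOpen (Set.range (s j)) :=
  (hs.isLocalDiffeomorph j).isOpen_range

theorem IsSheets.isClopen_sheet (hs : IsSheets A p s) (j : Fin m) :
    IsClopen {z : ↥(p ⁻¹' (A.R : Set X)) | (z : Y) ∈ Set.range (s j)} := by
  refine ⟨⟨?_⟩, (hs.isOpen_range j).preimage continuous_subtype_val⟩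
  -- The complement of a sheet is the union of the other sheets, hence open.
  have : {z : ↥(p ⁻¹' (A.R : Set X)) | (z : Y) ∈ Set.range (s j)}ᶜ =
      ⋃ i : {i // i ≠ j}, {z : ↥(p ⁻¹' (A.R : Set X)) | (z : Y) ∈ Set.range (s i)} := by
    ext z
    simp only [Set.mem_compl_iff, Set.mem_ofPred_eq, Set.mem_iUnion]
    constructor
    · intro h
      obtain ⟨i, hi⟩ := hs.exists_eq' z.2
      exact ⟨⟨i, fun hij => h ⟨_, hij ▸ hi⟩⟩, _, hi⟩
    · rintro ⟨⟨i, hi⟩, x, hx⟩ ⟨y, hy⟩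
      exact hi (hs.index_eq i j x y (hx.trans hy.symm))
  rw [this]
  exact isOpen_iUnion fun i => (hs.isOpen_range i).preimage continuous_subtype_val

/-- A bubble meets each fibre of a trivial covering at most once. -/
theorem IsSheets.eq_of_bubbleOf_eq (hs : IsSheets A p s) {z z' : Y} {hz : p z ∈ A.R}
    {hz' : p z' ∈ A.R} (h : bubbleOf A p z hz = bubbleOf A p z' hz') (hp : p z = p z') :
    z = z' := by
  obtain ⟨j, hj⟩ := hs.exists_eq' hz
  have h1 : (⟨z', hz'⟩ : ↥(p ⁻¹' (A.R : Set X))) ∈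
      connectedComponent (⟨z, hz⟩ : ↥(p ⁻¹' (A.R : Set X))) :=
    ConnectedComponents.coe_eq_coe'.1 h.symm
  -- A bubble stays inside one clopen sheet, and `p` is injective on a sheet.
  obtain ⟨y, hy⟩ := (hs.isClopen_sheet j).connectedComponent_subset
    (x := (⟨z, hz⟩ : ↥(p ⁻¹' (A.R : Set X)))) ⟨_, hj⟩ h1
  change s j y = z' at hy
  rw [← hj, ← hy]
  congr 1
  refine Subtype.ext ?_
  change p z = y
  rw [hp, ← hy, hs.map_eq]

theorem IsSheets.bubbleOf_eq (hs : IsSheets A p s) (j : Fin m) {x y : A.R}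
    (h : ConnectedComponents.mk x = ConnectedComponents.mk y) :
    bubbleOf A p (s j x) (hs.mem_R j x) = bubbleOf A p (s j y) (hs.mem_R j y) := by
  have hc : Continuous fun x : A.R => (⟨s j x, hs.mem_R j x⟩ : ↥(p ⁻¹' (A.R : Set X))) :=
    (hs.isLocalDiffeomorph j).contMDiff.continuous.subtype_mk _
  exact congrArg hc.connectedComponentsMap h

/-- The map `ψ` between trivial coverings of the regular part is a map over the regular part that
takes sheets to sheets locally. -/
def MapsSheets (s : Fin m → A.R → Y) (s' : Fin m → A.R → Y') (ψ : Y → Y') : Prop :=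
  ∀ i x, ∃ j, ∀ᶠ y in 𝓝 x, ψ (s i y) = s' j y

theorem MapsSheets.map_eq {ψ : Y → Y'} (hψ : MapsSheets s s' ψ) (hs : IsSheets A p s)
    (hs' : IsSheets A p' s') {z : Y} (hz : p z ∈ A.R) : p' (ψ z) = p z := by
  obtain ⟨i, x, rfl⟩ := hs.exists_eq z hz
  obtain ⟨j, hj⟩ := hψ i x
  rw [hj.self_of_nhds, hs'.map_eq, hs.map_eq]

/-- Near a point of the sheet `s i`, the map is `s' j` composed with a local inverse of `s i`. -/
theorem MapsSheets.contMDiffAt {ψ : Y → Y'} (hψ : MapsSheets s s' ψ) (hs : IsSheets A p s)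
    (hs' : IsSheets A p' s') {z : Y} (hz : p z ∈ A.R) : ContMDiffAt (𝓡 A.n) (𝓡 A.n) ∞ ψ z := by
  obtain ⟨i, x, rfl⟩ := hs.exists_eq z hz
  obtain ⟨j, hj⟩ := hψ i x
  have hi := hs.isLocalDiffeomorph i x
  let Ψ := hi.localInverse
  have h0 : Ψ (s i x) = x := hi.localInverse_left_inv hi.localInverse_mem_target
  have h1 : ContMDiffAt (𝓡 A.n) (𝓡 A.n) ∞ Ψ (s i x) := hi.localInverse_contMDiffAt
  have h2 : ContMDiffAt (𝓡 A.n) (𝓡 A.n) ∞ (s' j ∘ Ψ) (s i x) :=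
    (hs'.isLocalDiffeomorph j).contMDiff.contMDiffAt.comp _ h1
  refine h2.congr_of_eventuallyEq ?_
  have h3 : Tendsto Ψ (𝓝 (s i x)) (𝓝 x) := by simpa only [h0] using h1.continuousAt.tendsto
  filter_upwards [h3.eventually hj, Ψ.open_source.mem_nhds hi.localInverse_mem_source] with z hz hz'
  have h4 : s i (Ψ z) = z := hi.localInverse_right_inv hz'
  rw [h4] at hz
  exact hz

end Sheets

/-! ### Extension across the singular strata. -/

section Singular

variable {X : Type u} [TopologicalSpace X]
  {Y : Type w} [TopologicalSpace Y] {Y' : Type w'} [TopologicalSpace Y']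

theorem SimpleSpace.exists_mem_stratum (A : SimpleSpace X) {x : X} (hx : x ∉ A.R) :
    ∃ c : A.SingStratum, x ∈ A.stratum c :=
  ⟨ConnectedComponents.mk ⟨x, hx⟩, hx, rfl⟩

section UnfoldedChart

variable {A : SimpleSpace X} [ChartedSpace (EuclideanSpace ℝ (Fin A.n)) Y] {c : A.SingStratum}
  {L : Type v} [TopologicalSpace L] {k : ℕ} [ChartedSpace (EuclideanSpace ℝ (Fin k)) L]
  {p : Y → X} {α : ConeChart A c L k} {α' : α.U × L × ℝ → Y}

theorem IsUnfoldedChart.map_mem_R (h : IsUnfoldedChart p α α') (u : α.U) (l : L) {t : ℝ}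
    (ht : t ≠ 0) : p (α' (u, l, t)) ∈ A.R := by
  rw [h.2.2.2]
  exact α.mem_R u l (by simpa using ht)

/-- The point `p z` is the vertex of its cone, so the coordinate `t` of `z` satisfies `|t| = 0`. Any
unfolded chart over `p z` therefore contains the whole fibre, in its slice `t = 0`. -/
theorem IsUnfoldedChart.exists_eq (h : IsUnfoldedChart p α α') {z : Y}
    (hz : p z ∈ A.stratum c) (hU : (⟨p z, hz⟩ : A.stratum c) ∈ α.U) :
    ∃ l : L, α' (⟨⟨p z, hz⟩, hU⟩, l, 0) = z := by
  have h1 : α.toFun (⟨⟨p z, hz⟩, hU⟩, OpenCone.vertex L) = p z := α.map_vertex _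
  have h2 : z ∈ Set.range α' := by
    rw [h.2.2.1]
    exact ⟨_, h1⟩
  obtain ⟨⟨u, l, t⟩, rfl⟩ := h2
  refine ⟨l, ?_⟩
  have h3 := Prod.ext_iff.1 (α.isOpenEmbedding.injective (h1.trans (h.2.2.2 u l t)))
  have h4 : Real.nnabs t = 0 := OpenCone.mk_eq_vertex_iff.1 h3.2.symm
  have h5 : t = 0 := by simpa using h4
  subst h5
  exact congrArg (fun u => α' (u, l, 0)) h3.1

/-- A point of an unfolded manifold that lies over the same point as `β' (u, l, t)`, `t ≠ 0`, is
`β' (u, l, t)` or `β' (u, l, -t)`. -/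
theorem IsUnfoldedChart.eq_or_eq_neg (h : IsUnfoldedChart p α α') {u : α.U} {l : L} {t : ℝ}
    (ht : t ≠ 0) {z : Y} (hz : p z = α.toFun (u, OpenCone.mk l (Real.nnabs t))) :
    z = α' (u, l, t) ∨ z = α' (u, l, -t) := by
  have h2 : z ∈ Set.range α' := by
    rw [h.2.2.1]
    exact ⟨_, hz.symm⟩
  obtain ⟨⟨u', l', t'⟩, rfl⟩ := h2
  rw [h.2.2.2] at hz
  obtain ⟨rfl, rfl, h3⟩ := α.toFun_mk_inj (by simpa using ht) hz.symm
  have h4 : |t| = |t'| := by simpa using congrArg NNReal.toReal h3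
  rcases abs_eq_abs.1 h4 with rfl | rfl
  · exact Or.inl rfl
  · right
    rw [neg_neg]

end UnfoldedChart

/-- Two nowhere coinciding continuous maps `a`, `b` into a Hausdorff space: if a continuous map `f`
agrees with `a` or with `b` at each point of a preconnected set, then it agrees with the same one of
them on the whole set. -/
theorem IsPreconnected.eqOn_or_eqOn_of_forall_ne {Z : Type*} [TopologicalSpace Z] {W : Type*}
    [TopologicalSpace W] [T2Space W] {S : Set Z} (hS : IsPreconnected S) {f a b : Z → W}
    (hf : ContinuousOn f S) (ha : ContinuousOn a S) (hb : ContinuousOn b S)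
    (hab : ∀ q ∈ S, a q ≠ b q) (h : ∀ q ∈ S, f q = a q ∨ f q = b q) :
    Set.EqOn f a S ∨ Set.EqOn f b S := by
  have := isPreconnected_iff_preconnectedSpace.1 hS
  rw [continuousOn_iff_continuous_domRestrict] at hf ha hb
  -- Coincidence with `a` and coincidence with `b` are complementary closed conditions.
  have hc : IsClopen {q : S | S.domRestrict f q = S.domRestrict a q} := by
    refine ⟨isClosed_eq hf ha, ?_⟩
    have : {q : S | S.domRestrict f q = S.domRestrict a q} = {q | S.domRestrict f q = S.domRestrict b q}ᶜ := by
      ext ⟨q, hq⟩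
      change f q = a q ↔ ¬ (f q = b q)
      constructor
      · intro h1 h2
        exact hab q hq (h1.symm.trans h2)
      · exact fun h1 => (h q hq).resolve_right h1
    rw [this]
    exact (isClosed_eq hf hb).isOpen_compl
  rcases isClopen_iff.1 hc with h0 | h0
  · right
    intro q hq
    refine (h q hq).resolve_left fun h1 => ?_
    have : (⟨q, hq⟩ : S) ∈ {q : S | S.domRestrict f q = S.domRestrict a q} := h1
    rw [h0] at this
    exact this
  · left
    intro q hq
    have : (⟨q, hq⟩ : S) ∈ {q : S | S.domRestrict f q = S.domRestrict a q} := h0 ▸ Set.mem_univ _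
    exact this

theorem ChartedSpace.exists_isPreconnected_nhds {m : ℕ} {M : Type*} [TopologicalSpace M]
    [ChartedSpace (EuclideanSpace ℝ (Fin m)) M] {x : M} {N : Set M} (hN : N ∈ 𝓝 x) :
    ∃ V ∈ 𝓝 x, IsPreconnected V ∧ V ⊆ N := by
  have := ChartedSpace.locallyConnectedSpace (EuclideanSpace ℝ (Fin m)) M
  exact locallyConnectedSpace_iff_connected_subsets.1 this x N hN

/-- A continuous injective map over the regular part extends smoothly along an unfolded chart. -/
theorem IsUnfoldedChart.exists_contMDiffAt_eqOn {A : SimpleSpace X}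
    [ChartedSpace (EuclideanSpace ℝ (Fin A.n)) Y] [ChartedSpace (EuclideanSpace ℝ (Fin A.n)) Y']
    [T2Space Y'] {c : A.SingStratum}
    {L : Type v} [TopologicalSpace L] {k : ℕ} [ChartedSpace (EuclideanSpace ℝ (Fin k)) L]
    {p : Y → X} {p' : Y' → X} {α β : ConeChart A c L k} {α' : α.U × L × ℝ → Y}
    {β' : β.U × L × ℝ → Y'} (hα : IsUnfoldedChart p α α') (hβ : IsUnfoldedChart p' β β')
    (hαβ : α.Compatible β) {ψ : Y → Y'} (hψc : ContinuousOn ψ (p ⁻¹' (A.R : Set X)))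
    (hψp : ∀ z, p z ∈ A.R → p' (ψ z) = p z) (hψi : Set.InjOn ψ (p ⁻¹' (A.R : Set X)))
    (u₀ : α.U) (hu₀ : (u₀ : A.stratum c) ∈ β.U) (l₀ : L) :
    ∃ W ∈ 𝓝 (α' (u₀, l₀, 0)), ∃ f : Y → Y', ContMDiffOn (𝓡 A.n) (𝓡 A.n) ∞ f W ∧
      ∀ z ∈ W, p z ∈ A.R → f z = ψ z := by
  obtain ⟨N, hN, G, hG, hGeq⟩ := hαβ.exists_change u₀ hu₀ l₀
  obtain ⟨N₁, hN₁, N₂, hN₂, hNN⟩ := mem_nhds_prod_iff.1 hN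
  obtain ⟨V₁, hV₁, hVc₁, hVN₁⟩ := ChartedSpace.exists_isPreconnected_nhds (m := A.d c) hN₁
  obtain ⟨V₂, hV₂, hVc₂, hVN₂⟩ := ChartedSpace.exists_isPreconnected_nhds (m := k) hN₂
  have hVN : ∀ u ∈ V₁, ∀ l ∈ V₂, (u, l) ∈ N := fun u hu l hl => hNN ⟨hVN₁ hu, hVN₂ hl⟩
  have hα'c : Continuous α' := hα.1.contMDiff.continuous
  -- the candidates for the extension in the charts
  let F : ℝ → α.U × L × ℝ → Y' := fun ε q =>
    β' ((G (q.1, q.2.1)).1, (G (q.1, q.2.1)).2, ε * q.2.2)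
  let D : Set (α.U × L × ℝ) := {q | (q.1, q.2.1) ∈ N}
  have hF : ∀ ε, ContMDiffOn ((𝓡 (A.d c)).prod ((𝓡 k).prod 𝓘(ℝ, ℝ))) (𝓡 A.n) ∞ (F ε) D := by
    intro ε
    have h1 : ContMDiff ((𝓡 (A.d c)).prod ((𝓡 k).prod 𝓘(ℝ, ℝ))) ((𝓡 (A.d c)).prod (𝓡 k)) ∞
        (fun q : α.U × L × ℝ => (q.1, q.2.1)) :=
      contMDiff_fst.prodMk (contMDiff_fst.comp contMDiff_snd)
    have h2 := hG.comp h1.contMDiffOn (s := D) fun q hq => hq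
    have h3 : ContMDiff ((𝓡 (A.d c)).prod ((𝓡 k).prod 𝓘(ℝ, ℝ))) 𝓘(ℝ, ℝ) ∞
        (fun q : α.U × L × ℝ => ε * q.2.2) :=
      (contDiff_const.mul contDiff_id : ContDiff ℝ ∞ fun t : ℝ => ε * t).contMDiff.comp
        (contMDiff_snd.comp contMDiff_snd)
    have h4 := (contMDiff_fst.comp_contMDiffOn h2).prodMk
      ((contMDiff_snd.comp_contMDiffOn h2).prodMk h3.contMDiffOn)
    exact hβ.1.contMDiff.comp_contMDiffOn h4
  have hFne : ∀ q : α.U × L × ℝ, q.2.2 ≠ 0 → F 1 q ≠ F (-1) q := by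
    intro q hq h
    have h1 := hβ.2.1 h
    simp only [Prod.mk.injEq, true_and] at h1
    apply hq
    linarith
  have hor : ∀ q ∈ D, q.2.2 ≠ 0 → ψ (α' q) = F 1 q ∨ ψ (α' q) = F (-1) q := by
    rintro ⟨u, l, t⟩ hq ht
    have h1 := hα.map_mem_R u l ht
    have h2 := hψp _ h1
    rw [hα.2.2.2, hGeq (u, l) hq] at h2
    simpa [F] using hβ.eq_or_eq_neg ht h2
  -- On this connected positive half the two candidates `F 1` and `F (-1)` never meet, so the sign
  -- is constant.
  let S : Set (α.U × L × ℝ) := V₁ ×ˢ V₂ ×ˢ Set.Ioi 0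
  have hS : IsPreconnected S := hVc₁.prod (hVc₂.prod isPreconnected_Ioi)
  have hSD : S ⊆ D := fun q hq => hVN _ hq.1 _ hq.2.1
  have hψS : ContinuousOn (fun q => ψ (α' q)) S :=
    hψc.comp hα'c.continuousOn fun q hq => hα.map_mem_R q.1 q.2.1 (ne_of_gt hq.2.2)
  have hsign : ∃ ε : ℝ, ∀ q ∈ V₁ ×ˢ V₂ ×ˢ (Set.univ : Set ℝ), q.2.2 ≠ 0 → ψ (α' q) = F ε q := by
    have key : ∀ ε : ℝ, (ε = 1 ∨ ε = -1) → Set.EqOn (fun q => ψ (α' q)) (F ε) S →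
        ∀ q ∈ V₁ ×ˢ V₂ ×ˢ (Set.univ : Set ℝ), q.2.2 ≠ 0 → ψ (α' q) = F ε q := by
      rintro ε hε h ⟨u, l, t⟩ ⟨hu, hl, -⟩ ht
      rcases lt_or_gt_of_ne ht with h0 | h0
      · have h1 : ψ (α' (u, l, -t)) = F ε (u, l, -t) :=
          h (show (u, l, -t) ∈ S from ⟨hu, hl, neg_pos.2 h0⟩)
        -- For `t < 0` the wrong sign would give `F (-ε) (u, l, t) = F ε (u, l, -t)`, a value
        -- already taken at `(u, l, -t)`; injectivity of `ψ` excludes it.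
        have h2 : ψ (α' (u, l, t)) ≠ ψ (α' (u, l, -t)) := fun h3 => by
          have h4 := hα.2.1 (hψi (hα.map_mem_R u l ht) (hα.map_mem_R u l (neg_ne_zero.2 ht)) h3)
          simp only [Prod.mk.injEq, true_and] at h4
          linarith
        rw [h1] at h2
        rcases hor (u, l, t) (hVN u hu l hl) ht with h5 | h5 <;> rcases hε with rfl | rfl
        · exact h5
        · exact absurd (by simpa [F] using h5) h2
        · exact absurd (by simpa [F] using h5) h2
        · exact h5
      · exact h (show (u, l, t) ∈ S from ⟨hu, hl, h0⟩)
    rcases hS.eqOn_or_eqOn_of_forall_ne hψS ((hF 1).continuousOn.mono hSD)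
      ((hF (-1)).continuousOn.mono hSD) (fun q hq => hFne q (ne_of_gt hq.2.2))
      (fun q hq => hor q (hSD hq) (ne_of_gt hq.2.2)) with h | h
    · exact ⟨1, key 1 (Or.inl rfl) h⟩
    · exact ⟨-1, key (-1) (Or.inr rfl) h⟩
  obtain ⟨ε, hε⟩ := hsign
  have hq₀ := hα.1 (u₀, l₀, 0)
  let Ψ := hq₀.localInverse
  have hΨ₀ : Ψ (α' (u₀, l₀, 0)) = (u₀, l₀, 0) :=
    hq₀.localInverse_left_inv hq₀.localInverse_mem_target
  have hP : V₁ ×ˢ V₂ ×ˢ (Set.univ : Set ℝ) ∈ 𝓝 (Ψ (α' (u₀, l₀, 0))) := by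
    rw [hΨ₀]
    exact prod_mem_nhds hV₁ (prod_mem_nhds hV₂ univ_mem)
  refine ⟨Ψ.source ∩ Ψ ⁻¹' (V₁ ×ˢ V₂ ×ˢ (Set.univ : Set ℝ)),
    inter_mem (Ψ.open_source.mem_nhds hq₀.localInverse_mem_source)
      (hq₀.localInverse_contMDiffAt.continuousAt hP), fun z => F ε (Ψ z), ?_, ?_⟩
  · exact (hF ε).comp (Ψ.contMDiffOn.mono Set.inter_subset_left)
      fun z hz => hVN _ hz.2.1 _ hz.2.2.1
  · rintro z ⟨hz, hzV⟩ hR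
    have h1 : α' (Ψ z) = z := hq₀.localInverse_right_inv hz
    have h2 : (Ψ z).2.2 ≠ 0 := by
      intro h0
      rw [← h1, hα.2.2.2, h0] at hR
      have : OpenCone.mk (Ψ z).2.1 (Real.nnabs 0) = OpenCone.vertex L :=
        OpenCone.mk_eq_vertex_iff.2 (by simp)
      rw [this, α.map_vertex] at hR
      exact ((Ψ z).1 : A.stratum c).2.1 hR
    change F ε (Ψ z) = ψ z
    rw [← hε _ hzV h2, h1]

/-- The preimage of the regular part under an unfolding is dense. -/
theorem IsUnfolding.dense_preimage {A : ThomMatherSpace.{u, v} X}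
    [ChartedSpace (EuclideanSpace ℝ (Fin A.n)) Y] {p : Y → X} (hp : IsUnfolding A p) :
    Dense (p ⁻¹' (A.R : Set X)) := by
  intro z
  by_cases hz : p z ∈ A.R
  · exact subset_closure hz
  obtain ⟨c, hc⟩ := A.exists_mem_stratum hz
  obtain ⟨α, -, hU, α', hα⟩ := hp.exists_chart z c hc
  obtain ⟨l, hl⟩ := hα.exists_eq hc hU
  have h1 : Continuous fun t : ℝ => α' (⟨⟨p z, hc⟩, hU⟩, l, t) :=
    -- The point `z` is the limit at `t = 0` of the line `t ↦ α' (u, l, t)`, which lies over the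
    -- regular part for `t ≠ 0`.
    hα.1.contMDiff.continuous.comp (by fun_prop)
  have h2 : Tendsto (fun t : ℝ => α' (⟨⟨p z, hc⟩, hU⟩, l, t)) (𝓝[≠] 0) (𝓝 z) := by
    have := h1.tendsto 0
    rw [hl] at this
    exact this.mono_left nhdsWithin_le_nhds
  refine mem_closure_of_tendsto h2 ?_
  filter_upwards [self_mem_nhdsWithin] with t ht
  exact hα.map_mem_R _ _ ht

end Singular

/-- A map on a dense set that extends smoothly around each point extends to a smooth map. -/
theorem Dense.contMDiff_extendFrom {m : ℕ} {Y : Type w} [TopologicalSpace Y]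
    [ChartedSpace (EuclideanSpace ℝ (Fin m)) Y] {Y' : Type w'} [TopologicalSpace Y'] [T2Space Y']
    [ChartedSpace (EuclideanSpace ℝ (Fin m)) Y'] {S : Set Y} (hS : Dense S) {ψ : Y → Y'}
    (h : ∀ z, ∃ W ∈ 𝓝 z, ∃ f : Y → Y', ContMDiffOn (𝓡 m) (𝓡 m) ∞ f W ∧
      ∀ y ∈ W, y ∈ S → f y = ψ y) :
    ContMDiff (𝓡 m) (𝓡 m) ∞ (extendFrom S ψ) ∧ ∀ z ∈ S, extendFrom S ψ z = ψ z := by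
  -- Any local extension is the limit of `ψ` along `S`; so all of them agree with `extendFrom`, and
  -- no gluing condition is needed.
  have key : ∀ (W : Set Y) (f : Y → Y'), ContMDiffOn (𝓡 m) (𝓡 m) ∞ f W →
      (∀ y ∈ W, y ∈ S → f y = ψ y) → ∀ y, W ∈ 𝓝 y → extendFrom S ψ y = f y := by
    intro W f hf hfψ y hy
    refine extendFrom_eq (hS y) ?_
    refine ((hf.contMDiffAt hy).continuousAt.tendsto.mono_left nhdsWithin_le_nhds).congr' ?_
    filter_upwards [nhdsWithin_le_nhds hy, self_mem_nhdsWithin] with x hx hx'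
    exact hfψ x hx hx'
  refine ⟨fun z => ?_, fun z hz => ?_⟩
  · obtain ⟨W, hW, f, hf, hfψ⟩ := h z
    refine (hf.contMDiffAt hW).congr_of_eventuallyEq ?_
    filter_upwards [eventually_mem_nhds_iff.2 hW] with y hy
    exact key W f hf hfψ y hy
  · obtain ⟨W, hW, f, hf, hfψ⟩ := h z
    rw [key W f hf hfψ z hW, hfψ z (mem_of_mem_nhds hW) hz]

/-! ### From isomorphisms over the regular part to diffeomorphisms. -/

section Extension

variable {X : Type u} [TopologicalSpace X] {A : ThomMatherSpace.{u, v} X}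
  {Y : Type w} {Y' : Type w'}
  [TopologicalSpace Y] [ChartedSpace (EuclideanSpace ℝ (Fin A.n)) Y]
  [TopologicalSpace Y'] [ChartedSpace (EuclideanSpace ℝ (Fin A.n)) Y']
  {p : Y → X} {p' : Y' → X} {m : ℕ} {s : Fin m → A.R → Y} {s' : Fin m → A.R → Y'}

/-- The image is closed by properness and contains the dense regular part. -/
theorem IsPrimaryUnfolding.surjective (hp : IsPrimaryUnfolding A p) : Function.Surjective p := by
  obtain ⟨s, -, hs, -⟩ := hp.double
  have h1 : (A.R : Set X) ⊆ Set.range p := fun x hx => ⟨s 0 ⟨x, hx⟩, hs 0 ⟨x, hx⟩⟩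
  have h2 := (A.dense_R.mono h1).closure_eq
  rw [hp.proper.isClosedMap.isClosed_range.closure_eq] at h2
  exact Set.range_eq_univ.1 h2

/-- A map of double coverings over the regular part extends to a smooth map of the unfoldings. -/
theorem MapsSheets.exists_contMDiff [T2Space Y'] (hp : IsPrimaryUnfolding A p)
    (hp' : IsPrimaryUnfolding A p')
    (hs : IsSheets A.toSimpleSpace p s) (hs' : IsSheets A.toSimpleSpace p' s') {ψ : Y → Y'}
    (hψ : MapsSheets s s' ψ) (hψi : Set.InjOn ψ (p ⁻¹' (A.R : Set X))) :
    ∃ φ : Y → Y', ContMDiff (𝓡 A.n) (𝓡 A.n) ∞ φ ∧ (∀ z, p z ∈ A.R → φ z = ψ z) ∧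
      ∀ z, p' (φ z) = p z := by
  have := A.metrizable
  have hψp : ∀ z, p z ∈ A.R → p' (ψ z) = p z := fun z hz => hψ.map_eq hs hs' hz
  have hψs : ∀ z, p z ∈ A.R → ContMDiffAt (𝓡 A.n) (𝓡 A.n) ∞ ψ z :=
    fun z hz => hψ.contMDiffAt hs hs' hz
  have hψc : ContinuousOn ψ (p ⁻¹' (A.R : Set X)) :=
    fun z hz => (hψs z hz).continuousAt.continuousWithinAt
  have hd := hp.toIsUnfolding.dense_preimage
  have hext : ∀ z, ∃ W ∈ 𝓝 z, ∃ f : Y → Y', ContMDiffOn (𝓡 A.n) (𝓡 A.n) ∞ f W ∧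
      ∀ y ∈ W, y ∈ p ⁻¹' (A.R : Set X) → f y = ψ y := by
    intro z
    by_cases hz : p z ∈ A.R
    · exact ⟨p ⁻¹' (A.R : Set X), (A.R.isOpen.preimage hp.continuous).mem_nhds hz, ψ,
        fun y hy => (hψs y hy).contMDiffWithinAt, fun y _ _ => rfl⟩
    · obtain ⟨c, hc⟩ := A.exists_mem_stratum hz
      -- Any point of the fibre will do: it only serves to provide an unfolded chart of `p'` over `p
      -- z`.
      obtain ⟨z', hz'⟩ := hp'.surjective (p z)
      obtain ⟨α, hα, hU, α', hα'⟩ := hp.exists_chart z c hc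
      obtain ⟨β, hβ, hU', β', hβ'⟩ := hp'.exists_chart z' c (hz' ▸ hc)
      obtain ⟨l, hl⟩ := hα'.exists_eq hc hU
      have hu : (⟨p z, hc⟩ : A.stratum c) ∈ β.U := by simpa only [hz'] using hU'
      have := hα'.exists_contMDiffAt_eqOn hβ' (hα.compatible hβ) hψc hψp hψi
        ⟨⟨p z, hc⟩, hU⟩ hu l
      rwa [hl] at this
  obtain ⟨h1, h2⟩ := hd.contMDiff_extendFrom hext
  refine ⟨_, h1, h2, fun z => ?_⟩
  have h3 : Set.EqOn (p' ∘ extendFrom (p ⁻¹' (A.R : Set X)) ψ) p (p ⁻¹' (A.R : Set X)) := by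
    intro y hy
    rw [Function.comp_apply, h2 y hy, hψp y hy]
  exact congrFun (Continuous.ext_on hd (hp'.continuous.comp h1.continuous) hp.continuous h3) z

/-- An isomorphism of double coverings over the regular part extends to a diffeomorphism of the
unfoldings. -/
theorem MapsSheets.exists_diffeomorph [T2Space Y] [T2Space Y'] (hp : IsPrimaryUnfolding A p)
    (hp' : IsPrimaryUnfolding A p')
    (hs : IsSheets A.toSimpleSpace p s) (hs' : IsSheets A.toSimpleSpace p' s') {ψ : Y → Y'}
    {ψ' : Y' → Y} (hψ : MapsSheets s s' ψ) (hψ' : MapsSheets s' s ψ')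
    (h : ∀ z, p z ∈ A.R → ψ' (ψ z) = z) (h' : ∀ z, p' z ∈ A.R → ψ (ψ' z) = z) :
    ∃ φ : Y ≃ₘ^∞⟮𝓡 A.n, 𝓡 A.n⟯ Y', (∀ z, p z ∈ A.R → φ z = ψ z) ∧ ∀ z, p' (φ z) = p z := by
  obtain ⟨φ, h1, h2, h3⟩ := hψ.exists_contMDiff hp hp' hs hs'
    fun z hz y hy hzy => by rw [← h z hz, hzy, h y hy]
  obtain ⟨φ', h1', h2', h3'⟩ := hψ'.exists_contMDiff hp' hp hs' hs
    fun z hz y hy hzy => by rw [← h' z hz, hzy, h' y hy]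
  have hl : φ' ∘ φ = id := by
    refine Continuous.ext_on hp.toIsUnfolding.dense_preimage
      (h1'.continuous.comp h1.continuous) continuous_id fun z hz => ?_
    have hz' : p' (φ z) ∈ A.R := by rw [h3]; exact hz
    rw [Function.comp_apply, h2' _ hz', h2 z hz, h z hz, id]
  have hr : φ ∘ φ' = id := by
    refine Continuous.ext_on hp'.toIsUnfolding.dense_preimage
      (h1.continuous.comp h1'.continuous) continuous_id fun z hz => ?_
    have hz' : p (φ' z) ∈ A.R := by rw [h3']; exact hz
    rw [Function.comp_apply, h2 _ hz', h2' z hz, h' z hz, id]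
  exact ⟨⟨⟨φ, φ', congrFun hl, congrFun hr⟩, h1, h1'⟩, h2, h3⟩

end Extension

/-! ### Labellings of the bubbles. -/

section Bubbles

variable {X : Type u} [TopologicalSpace X] {A : SimpleSpace X}
  {Y : Type w} [TopologicalSpace Y] {Y' : Type w'} [TopologicalSpace Y']
  {p : Y → X} {p' : Y' → X}

theorem IsBubbleLabelling.symm {σ : Bubble A p ≃ Bubble A p'} (hσ : IsBubbleLabelling A p p' σ) :
    IsBubbleLabelling A p' p σ.symm := fun z' z hz' hz h =>
  (hσ z z' hz hz' ((Equiv.symm_apply_eq σ).1 h).symm).symm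

theorem IsSheets.bubbleOf_mk_eq [ChartedSpace (EuclideanSpace ℝ (Fin A.n)) Y] {m : ℕ}
    {s : Fin m → A.R → Y} (hs : IsSheets A p s) {j : Fin m} {x : A.R} {z : Y} (hz : p z ∈ A.R)
    (hj : s j x = z) : bubbleOf A p (s j x) (hs.mem_R j x) = bubbleOf A p z hz := by
  subst hj
  rfl

/-- A bubble labelling is induced by a map of coverings of the regular part. -/
theorem IsBubbleLabelling.exists_mapsSheets [ChartedSpace (EuclideanSpace ℝ (Fin A.n)) Y]
    [ChartedSpace (EuclideanSpace ℝ (Fin A.n)) Y'] {m : ℕ} {s : Fin m → A.R → Y}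
    {s' : Fin m → A.R → Y'} (hs : IsSheets A p s) (hs' : IsSheets A p' s')
    (hsurj : Function.Surjective p') {σ : Bubble A p ≃ Bubble A p'} (hσ : IsBubbleLabelling A p p' σ) :
    ∃ ψ : Y → Y', MapsSheets s s' ψ ∧ ∀ (z : Y) (hz : p z ∈ A.R), p' (ψ z) = p z ∧
      ∃ hz' : p' (ψ z) ∈ A.R, σ (bubbleOf A p z hz) = bubbleOf A p' (ψ z) hz' := by
  have hex : ∀ (z : Y) (hz : p z ∈ A.R), ∃ z' : Y', p' z' = p z ∧
      ∃ hz' : p' z' ∈ A.R, σ (bubbleOf A p z hz) = bubbleOf A p' z' hz' := by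
    intro z hz
    -- Take any point of the target bubble and move along its sheet to the fibre over `p z`. This
    -- stays in the bubble, because a labelling preserves the component of the regular part.
    obtain ⟨⟨y, hy⟩, hσy⟩ := ConnectedComponents.surjective_coe (σ (bubbleOf A p z hz))
    obtain ⟨j, hj⟩ := hs'.exists_eq' hy
    refine ⟨s' j ⟨p z, hz⟩, hs'.map_eq _ _, hs'.mem_R _ _, ?_⟩
    rw [hs'.bubbleOf_eq j (hσ z y hz hy hσy.symm), hs'.bubbleOf_mk_eq hy hj]
    exact hσy.symm
  have hex' : ∀ z : Y, ∃ z' : Y', ∀ hz : p z ∈ A.R, p' z' = p z ∧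
      ∃ hz' : p' z' ∈ A.R, σ (bubbleOf A p z hz) = bubbleOf A p' z' hz' := by
    intro z
    by_cases hz : p z ∈ A.R
    · obtain ⟨z', h⟩ := hex z hz
      exact ⟨z', fun _ => h⟩
    · obtain ⟨z', -⟩ := hsurj (p z)
      exact ⟨z', fun h => absurd h hz⟩
  choose ψ hψ using hex'
  refine ⟨ψ, fun i x => ?_, hψ⟩
  obtain ⟨hψp, hψR, hψσ⟩ := hψ (s i x) (hs.mem_R i x)
  obtain ⟨j, hj⟩ := hs'.exists_eq' hψR
  have hx : (⟨p' (ψ (s i x)), hψR⟩ : A.R) = x := Subtype.ext (hψp.trans (hs.map_eq i x))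
  rw [hx] at hj
  refine ⟨j, ?_⟩
  -- Components of the regular part are open, and over the component of `x` the target sheet remains
  -- `s' j`.
  have := ChartedSpace.locallyConnectedSpace (EuclideanSpace ℝ (Fin A.n)) A.R
  filter_upwards [isOpen_connectedComponent.mem_nhds (mem_connectedComponent (x := x))] with y hy
  have hxy : ConnectedComponents.mk x = ConnectedComponents.mk y :=
    (ConnectedComponents.coe_eq_coe'.2 hy).symm
  obtain ⟨hyp, hyR, hyσ⟩ := hψ (s i y) (hs.mem_R i y)
  refine hs'.eq_of_bubbleOf_eq (hz := hyR) (hz' := hs'.mem_R j y) ?_ ?_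
  · rw [← hyσ, ← hs.bubbleOf_eq i hxy, hψσ, ← hs'.bubbleOf_eq j hxy, hs'.bubbleOf_mk_eq hψR hj]
  · rw [hyp, hs.map_eq, hs'.map_eq]

/-- A homeomorphism over the base induces exactly one bubble labelling. -/
theorem Homeomorph.existsUnique_bubbleLabelling (φ : Y ≃ₜ Y') (hφ : ∀ z, p' (φ z) = p z)
    (hp' : Continuous p') :
    ∃! σ : Bubble A p ≃ Bubble A p', IsBubbleLabelling A p p' σ ∧ InducesOnBubbles A p p' φ σ := by
  let e : ↥(p ⁻¹' (A.R : Set X)) ≃ₜ ↥(p' ⁻¹' (A.R : Set X)) :=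
    φ.subtype fun z => by simp [hφ]
  let σ : Bubble A p ≃ Bubble A p' :=
    { toFun := e.continuous.connectedComponentsMap
      invFun := e.symm.continuous.connectedComponentsMap
      left_inv := by
        rintro ⟨z⟩
        exact congrArg ConnectedComponents.mk (e.symm_apply_apply z)
      right_inv := by
        rintro ⟨z⟩
        exact congrArg ConnectedComponents.mk (e.apply_symm_apply z) }
  have hmem : ∀ z, p z ∈ A.R → p' (φ z) ∈ A.R := fun z hz => by rwa [hφ]
  have hσ : ∀ (z : Y) (hz : p z ∈ A.R),
      σ (bubbleOf A p z hz) = bubbleOf A p' (φ z) (hmem z hz) := fun z hz => rfl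
  refine ⟨σ, ⟨?_, fun z hz => ⟨_, hσ z hz⟩⟩, ?_⟩
  · intro z z' hz hz' h
    rw [hσ] at h
    -- Being continuous, `p'` sends each bubble into a single component of the regular part.
    have hc : Continuous fun z : ↥(p' ⁻¹' (A.R : Set X)) => (⟨p' z, z.2⟩ : A.R) :=
      (hp'.comp continuous_subtype_val).subtype_mk _
    have h1 : ConnectedComponents.mk (⟨p' (φ z), hmem z hz⟩ : A.R) =
        ConnectedComponents.mk (⟨p' z', hz'⟩ : A.R) := congrArg hc.connectedComponentsMap h
    rw [← h1]
    exact congrArg ConnectedComponents.mk (Subtype.ext (hφ z).symm)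
  · rintro τ ⟨-, hτ⟩
    ext b
    obtain ⟨⟨z, hz⟩, rfl⟩ := ConnectedComponents.surjective_coe b
    obtain ⟨_, h⟩ := hτ z hz
    exact h

end Bubbles

theorem IsPrimaryUnfolding.exists_isSheets {X : Type u} [TopologicalSpace X]
    {A : ThomMatherSpace.{u, v} X} {Y : Type w} [TopologicalSpace Y]
    [ChartedSpace (EuclideanSpace ℝ (Fin A.n)) Y] {p : Y → X} (hp : IsPrimaryUnfolding A p) :
    ∃ s : Fin 2 → A.R → Y, IsSheets A.toSimpleSpace p s := by
  obtain ⟨s, h1, h2, h3, h4⟩ := hp.double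
  exact ⟨s, h1, h2, h3, h4⟩

/-- The map that sends the point of the sheet `s j` over `x` to the point of the sheet `s' j`
over `x`. -/
theorem IsSheets.exists_map {X : Type u} [TopologicalSpace X] {A : SimpleSpace X}
    {Y : Type w} [TopologicalSpace Y] [ChartedSpace (EuclideanSpace ℝ (Fin A.n)) Y]
    {Y' : Type w'} {p : Y → X} {p' : Y' → X} {m : ℕ} {s : Fin m → A.R → Y}
    (hs : IsSheets A p s) (hsurj : Function.Surjective p') (s' : Fin m → A.R → Y') :
    ∃ ψ : Y → Y', ∀ j x, ψ (s j x) = s' j x := by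
  have h : ∀ z : Y, ∃ z' : Y', ∀ j x, s j x = z → z' = s' j x := by
    intro z
    by_cases hz : p z ∈ A.R
    · obtain ⟨j, hj⟩ := hs.exists_eq' hz
      refine ⟨s' j ⟨p z, hz⟩, fun i x hi => ?_⟩
      obtain rfl := hs.index_eq i j x _ (hi.trans hj.symm)
      exact congrArg (s' i) (Subtype.ext ((congrArg p hi).symm.trans (hs.map_eq i x)))
    -- Off the regular part the value is arbitrary; surjectivity only ensures that there is one.
    · obtain ⟨z', -⟩ := hsurj (p z)
      exact ⟨z', fun j x hj => absurd (hj ▸ hs.mem_R j x) hz⟩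
  choose ψ hψ using h
  exact ⟨ψ, fun j x => hψ _ j x rfl⟩

/-! ### The uniqueness theorem. -/

theorem mainTheorem4 {X : Type u} [TopologicalSpace X] (A : ThomMatherSpace.{u, v} X)
    {Y : Type w} {Y' : Type w'}
    [TopologicalSpace Y] [T2Space Y] [SecondCountableTopology Y]
    [ChartedSpace (EuclideanSpace ℝ (Fin A.n)) Y] [IsManifold (𝓡 A.n) ∞ Y]
    [TopologicalSpace Y'] [T2Space Y'] [SecondCountableTopology Y']
    [ChartedSpace (EuclideanSpace ℝ (Fin A.n)) Y'] [IsManifold (𝓡 A.n) ∞ Y']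
    (p : Y → X) (hp : IsPrimaryUnfolding A p) (p' : Y' → X) (hp' : IsPrimaryUnfolding A p') :
    (∃ φ : Y ≃ₘ^∞⟮𝓡 A.n, 𝓡 A.n⟯ Y', ∀ z, p' (φ z) = p z) ∧
    (∀ φ : Y ≃ₘ^∞⟮𝓡 A.n, 𝓡 A.n⟯ Y', (∀ z, p' (φ z) = p z) →
      ∃! σ : Bubble A.toSimpleSpace p ≃ Bubble A.toSimpleSpace p',
        IsBubbleLabelling A.toSimpleSpace p p' σ ∧
        InducesOnBubbles A.toSimpleSpace p p' φ σ) ∧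
    (∀ σ : Bubble A.toSimpleSpace p ≃ Bubble A.toSimpleSpace p',
      IsBubbleLabelling A.toSimpleSpace p p' σ →
      ∃! φ : Y ≃ₘ^∞⟮𝓡 A.n, 𝓡 A.n⟯ Y',
        (∀ z, p' (φ z) = p z) ∧ InducesOnBubbles A.toSimpleSpace p p' φ σ) := by
  obtain ⟨s, hs⟩ := hp.exists_isSheets
  obtain ⟨s', hs'⟩ := hp'.exists_isSheets
  refine ⟨?_, fun φ hφ => φ.toHomeomorph.existsUnique_bubbleLabelling hφ hp'.continuous, ?_⟩
  · obtain ⟨ψ, hψ⟩ := hs.exists_map hp'.surjective s'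
    obtain ⟨ψ', hψ'⟩ := hs'.exists_map hp.surjective s
    have hm : MapsSheets s s' ψ := fun i x => ⟨i, Eventually.of_forall fun y => hψ i y⟩
    have hm' : MapsSheets s' s ψ' := fun i x => ⟨i, Eventually.of_forall fun y => hψ' i y⟩
    obtain ⟨φ, -, hφ⟩ := hm.exists_diffeomorph hp hp' hs hs' hm'
      (fun z hz => by
        obtain ⟨j, x, rfl⟩ := hs.exists_eq z hz
        rw [hψ, hψ'])
      (fun z hz => by
        obtain ⟨j, x, rfl⟩ := hs'.exists_eq z hz
        rw [hψ', hψ])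
    exact ⟨φ, hφ⟩
  · intro σ hσ
    obtain ⟨ψ, hm, hψ⟩ := hσ.exists_mapsSheets hs hs' hp'.surjective
    obtain ⟨ψ', hm', hψ'⟩ := hσ.symm.exists_mapsSheets hs' hs hp.surjective
    obtain ⟨φ, hφψ, hφ⟩ := hm.exists_diffeomorph hp hp' hs hs' hm'
      (fun z hz => by
        obtain ⟨h1, h2, h3⟩ := hψ z hz
        obtain ⟨h1', h2', h3'⟩ := hψ' (ψ z) h2
        -- The composite preserves fibres and, as `σ.symm` undoes `σ`, also bubbles; hence it fixes
        -- every point over the regular part.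
        refine hs.eq_of_bubbleOf_eq (hz := h2') (hz' := hz) ?_ (h1'.trans h1)
        rw [← h3', ← h3, Equiv.symm_apply_apply])
      (fun z hz => by
        obtain ⟨h1, h2, h3⟩ := hψ' z hz
        obtain ⟨h1', h2', h3'⟩ := hψ (ψ' z) h2
        refine hs'.eq_of_bubbleOf_eq (hz := h2') (hz' := hz) ?_ (h1'.trans h1)
        rw [← h3', ← h3, Equiv.apply_symm_apply])
    refine ⟨φ, ⟨hφ, fun z hz => ?_⟩, ?_⟩
    · rw [hφψ z hz]
      exact (hψ z hz).2
    · rintro χ ⟨hχ, hχσ⟩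
      -- By density it suffices to compare `χ` and `φ` over the regular part, where both values lie
      -- in the same fibre and the same bubble.
      refine Diffeomorph.ext fun z => congrFun (Continuous.ext_on hp.toIsUnfolding.dense_preimage
        χ.continuous φ.continuous fun y hy => ?_) z
      obtain ⟨h1, h2⟩ := hχσ y hy
      obtain ⟨h3, h4, h5⟩ := hψ y hy
      rw [hφψ y hy]
      exact hs'.eq_of_bubbleOf_eq (hz := h1) (hz' := h4) (h2.symm.trans h5)
        ((hχ y).trans h3.symm)
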